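/- Let $\mathsf X$ be a measurable space with a $\sigma$-finite reference measure $\mathrm dy$ (e.g. Lebesgue or counting measure), let $\pi$ be a probability density on $\mathsf X$ (we also write $\pi$ for the corresponding distribution) and let $q(x,\cdot)$, $x\in\mathsf X$, be probability densities on $\mathsf X$, jointly measurable in $(x,y)$. Put $$r(x,y)=\frac{\pi(y)q(y,x)}{\pi(x)q(x,y)}$$ (with $r(x,y):=0$ if $\pi(x)q(x,y)=0$, which concerns only a null set of $\pi(\mathrm dx)q(x,y)\,\mathrm dy$), and let $d\ge 1$ and measurable functions $\rho_1,\dots,\rho_d:\mathsf X^2\to[0,\infty)$ be such that $r(x,y)=\prod_{k=1}^d\rho_k(x,y)$ whenever $\pi(x)q(x,y)>0$, and $\rho_k(x,y)=\rho_k(y,x)^{-1}$ for all $k$ whenever $\pi(x)q(x,y)>0$ and $\pi(y)q(y,x)>0$. Let $\alpha(x,y)=\min\{1,r(x,y)\}$, $\tilde\alpha(x,y)=\prod_{k=1}^d\min\{1,\rho_k(x,y)\}$, and let $P$ (Metropolis--Hastings) and $\tilde P$ (Delayed Acceptance) be the Markov kernels $$P(x,A)=\int_A q(x,y)\alpha(x,y)\,\mathrm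 dy+\Bigl(1-\int_{\mathsf X} q(x,y)\alpha(x,y)\,\mathrm dy\Bigr)\mathbf 1_A(x),$$ $$\tilde P(x,A)=\int_A q(x,y)\tilde\alpha(x,y)\,\mathrm dy+\Bigl(1-\int_{\mathsf X} q(x,y)\tilde\alpha(x,y)\,\mathrm dy\Bigr)\mathbf 1_A(x).$$ For a $\pi$-reversible Markov kernel $\Pi$ let $$\mathcal E_\Pi(f)=\tfrac12\int\pi(\mathrm dx)\,\Pi(x,\mathrm dy)\,[f(x)-f(y)]^2,\qquad \mathrm{Gap}(\Pi)=\inf\Bigl\{\frac{\mathcal E_\Pi(f)}{\pi(f^2)}: f\in L^2(\pi),\ \pi(f)=0,\ f\ne 0\Bigr\},$$ $$\mathrm{var}(f,\Pi)=\lim_{n\to\infty}\mathrm{var}\Bigl(n^{-1/2}\sum_{i=1}^n[f(X_i)-\pi(f)]\Bigr)\in[0,\infty],$$ where $(X_n)_{n\ge1}$ is a Markov chain with kernel $\Pi$ and $X_1\sim\pi$. Proposition. Assume that there is $c\in(0,1]$ such that $\rho_k(x,y)\ge c$ for all $k\in\{1,\dots,d\}$ and all $(x,y)\in\mathsf X^2$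 with $r(x,y)\ge 1$, and put $\varrho=c^{d-1}$. Then $P$ and $\tilde P$ are $\pi$-reversible, and: 1. $\mathcal E_{\tilde P}(f)\ge\varrho\,\mathcal E_P(f)$ for every $f\in L^2(\pi)$; 2. $\mathrm{Gap}(\tilde P)\ge\varrho\,\mathrm{Gap}(P)$; 3. for every $f\in L^2(\pi)$ the limits defining $\mathrm{var}(f,P)$ and $\mathrm{var}(f,\tilde P)$ exist in $[0,\infty]$, and $$\mathrm{var}(f,\tilde P)\le(\varrho^{-1}-1)\,\mathrm{var}_\pi(f)+\varrho^{-1}\,\mathrm{var}(f,P).$$ -/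

import Mathlib

open MeasureTheory ProbabilityTheory Filter Topology
open scoped NNReal ENNReal

namespace DelayedAcceptance

noncomputable section

/-! ### General notions for a Markov kernel `Π` with invariant probability measure `μ` -/

/-- The Dirichlet form `(1/2) ∫ μ(dx) Π(x,dy) (f x - f y)²`, as a number in `[0,∞]`. -/
def dirichletForm {X : Type*} [MeasurableSpace X] (P : Kernel X X) (μ : Measure X)
    (f : X → ℝ) : ℝ≥0∞ :=
  (1 / 2) * ∫⁻ x, ∫⁻ y, ENNReal.ofReal ((f x - f y) ^ 2) ∂(P x) ∂μ

/-- The right spectral gap: the infimum of `dirichletForm P μ f / ⟨f, f⟩_μ` over the nonzero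
`f` in `L²₀(μ)`. -/
def spectralGap {X : Type*} [MeasurableSpace X] (P : Kernel X X) (μ : Measure X) : ℝ≥0∞ :=
  ⨅ (f : X → ℝ) (_ : MemLp f 2 μ) (_ : ∫ x, f x ∂μ = 0) (_ : ¬ f =ᵐ[μ] 0),
    dirichletForm P μ f / ∫⁻ x, ENNReal.ofReal (f x ^ 2) ∂μ

/-- The law on `ℕ → X` of the time-homogeneous Markov chain with kernel `P` and initial
distribution `μ`. -/
def chainLaw {X : Type*} [MeasurableSpace X] (P : Kernel X X) [IsMarkovKernel P]
    (μ : Measure X) : Measure (ℕ → X) :=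
  Kernel.trajMeasure (X := fun _ => X) μ
    (fun n => P.comap (fun h : (i : Finset.Iic n) → X => h ⟨n, Finset.mem_Iic.2 le_rfl⟩)
      (measurable_pi_apply _))

/-- The variance of `n^{-1/2} ∑ (f(X_i) - μ(f))`, the sum being over the first `n` states of the
chain with kernel `P` started from `μ`. -/
def scaledVariance {X : Type*} [MeasurableSpace X] (P : Kernel X X) [IsMarkovKernel P]
    (μ : Measure X) (f : X → ℝ) (n : ℕ) : ℝ≥0∞ :=
  evariance
    (fun w : ℕ → X => (Real.sqrt n)⁻¹ * ∑ i ∈ Finset.range n, (f (w i) - ∫ x, f x ∂μ))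
    (chainLaw P μ)

/-- The asymptotic variance `var(f, P)`, a number in `[0,∞]`: the limit of `scaledVariance`.
It is written as an upper limit, which is the limit whenever the limit exists. -/
def asymptoticVariance {X : Type*} [MeasurableSpace X] (P : Kernel X X) [IsMarkovKernel P]
    (μ : Measure X) (f : X → ℝ) : ℝ≥0∞ :=
  limsup (fun n : ℕ => scaledVariance P μ f n) atTop

/-! ### Accept-reject kernels -/

/-- The kernel `A ↦ ∫_A q(x,y) a(x,y) ν(dy) + (1 - ∫ q(x,y) a(x,y) ν(dy)) 1_A(x)`: propose from
the density `q(x,·)`, accept with probability `a(x,y)`. -/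
def acceptKernel {X : Type*} [MeasurableSpace X] (ν : Measure X) [SigmaFinite ν]
    (q a : X → X → ℝ≥0) (hq : Measurable (Function.uncurry q))
    (ha : Measurable (Function.uncurry a)) : Kernel X X where
  toFun x := ν.withDensity (fun y => (q x y : ℝ≥0∞) * a x y)
    + (1 - ∫⁻ y, (q x y : ℝ≥0∞) * a x y ∂ν) • Measure.dirac x
  measurable' := by
    have hqa : Measurable (Function.uncurry fun x y => (q x y : ℝ≥0∞) * a x y) :=
      hq.coe_nnreal_ennreal.mul ha.coe_nnreal_ennreal
    refine Measure.measurable_of_measurable_coe _ fun s hs => ?_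
    simp only [Measure.add_apply, Measure.smul_apply, smul_eq_mul,
      withDensity_apply _ hs, Measure.dirac_apply' _ hs]
    refine Measurable.add ?_ (Measurable.mul ?_ ?_)
    · exact hqa.lintegral_prod_right'
    · exact measurable_const.sub hqa.lintegral_prod_right'
    · exact measurable_one.indicator hs

theorem acceptKernel_isMarkovKernel {X : Type*} [MeasurableSpace X] (ν : Measure X)
    [SigmaFinite ν] (q a : X → X → ℝ≥0) (hq : Measurable (Function.uncurry q))
    (ha : Measurable (Function.uncurry a)) (hq1 : ∀ x, ∫⁻ y, (q x y : ℝ≥0∞) ∂ν = 1)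
    (ha1 : ∀ x y, a x y ≤ 1) : IsMarkovKernel (acceptKernel ν q a hq ha) := by
  refine ⟨fun x => ⟨?_⟩⟩
  have hle : ∫⁻ y, (q x y : ℝ≥0∞) * a x y ∂ν ≤ 1 := by
    rw [← hq1 x]
    refine lintegral_mono fun y => ?_
    calc (q x y : ℝ≥0∞) * a x y ≤ q x y * 1 := by gcongr; exact_mod_cast ha1 x y
      _ = q x y := mul_one _
  change (ν.withDensity (fun y => (q x y : ℝ≥0∞) * a x y)
    + (1 - ∫⁻ y, (q x y : ℝ≥0∞) * a x y ∂ν) • Measure.dirac x) Set.univ = 1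
  simp [add_tsub_cancel_of_le hle]

/-! ### Metropolis-Hastings -/

/-- The data of a Metropolis-Hastings algorithm on `X`: a target probability density `π` and a
proposal density `q x ·` for every state `x`, with respect to the reference measure `ν`. -/
structure MHData {X : Type*} [MeasurableSpace X] (ν : Measure X) where
  /-- the target density -/
  π : X → ℝ≥0
  /-- the proposal density -/
  q : X → X → ℝ≥0
  measurable_π : Measurable π
  measurable_q : Measurable (Function.uncurry q)
  lintegral_π : ∫⁻ x, (π x : ℝ≥0∞) ∂ν = 1
  lintegral_q : ∀ x, ∫⁻ y, (q x y : ℝ≥0∞) ∂ν = 1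

variable {X : Type*} [MeasurableSpace X] {ν : Measure X}

/-- The target distribution `π(x) ν(dx)`. -/
def MHData.target (M : MHData ν) : Measure X :=
  ν.withDensity fun x => (M.π x : ℝ≥0∞)

/-- The acceptance ratio `r(x,y)`. By the convention for division it is `0` where
`π(x) q(x,y) = 0`; such pairs form a null set for `π(dx) q(x,y) ν(dy)`. -/
def MHData.ratio (M : MHData ν) (x y : X) : ℝ≥0 :=
  (M.π y * M.q y x) / (M.π x * M.q x y)

/-- The acceptance probability `α(x,y) = 1 ∧ r(x,y)`. -/
def MHData.accept (M : MHData ν) (x y : X) : ℝ≥0 := min 1 (M.ratio x y)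

theorem MHData.measurable_accept (M : MHData ν) : Measurable (Function.uncurry M.accept) := by
  have hq : Measurable fun p : X × X => M.q p.1 p.2 := M.measurable_q
  have hq' : Measurable fun p : X × X => M.q p.2 p.1 := M.measurable_q.comp measurable_swap
  have h1 : Measurable fun p : X × X => M.π p.1 := M.measurable_π.comp measurable_fst
  have h2 : Measurable fun p : X × X => M.π p.2 := M.measurable_π.comp measurable_snd
  exact measurable_const.min ((h2.mul hq').div (h1.mul hq))

/-- The Metropolis-Hastings kernel `P`. -/
def MHData.kernel [SigmaFinite ν] (M : MHData ν) : Kernel X X :=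
  acceptKernel ν M.q M.accept M.measurable_q M.measurable_accept

instance [SigmaFinite ν] (M : MHData ν) : IsMarkovKernel M.kernel :=
  acceptKernel_isMarkovKernel ν _ _ _ _ M.lintegral_q fun _ _ => min_le_left _ _

/-! ### Delayed acceptance -/

/-- A factorisation `r(x,y) = ∏ ρ_k(x,y)` of the acceptance ratio into `d` factors satisfying the
balance condition `ρ_k(x,y) = ρ_k(y,x)⁻¹`. The factorisation is required where `r(x,y)` is
defined, the balance condition where `r(x,y)` and `r(y,x)` are both defined and positive; there
all the factors are positive. If `π` and `q` are positive, both are required everywhere. -/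
structure Factorisation (M : MHData ν) (d : ℕ) where
  /-- the factors -/
  ρ : Fin d → X → X → ℝ≥0
  measurable_ρ : ∀ k, Measurable (Function.uncurry (ρ k))
  prod_eq : ∀ x y, 0 < M.π x * M.q x y → M.ratio x y = ∏ k, ρ k x y
  balance : ∀ k x y, 0 < M.π x * M.q x y → 0 < M.π y * M.q y x → ρ k x y = (ρ k y x)⁻¹

/-- The delayed acceptance probability `α̃(x,y) = ∏ (1 ∧ ρ_k(x,y))`. -/
def Factorisation.accept {M : MHData ν} {d : ℕ} (F : Factorisation M d) (x y : X) : ℝ≥0 :=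
  ∏ k, min 1 (F.ρ k x y)

theorem Factorisation.measurable_accept {M : MHData ν} {d : ℕ} (F : Factorisation M d) :
    Measurable (Function.uncurry F.accept) := by
  have h : Measurable fun p : X × X => ∏ k, min 1 (F.ρ k p.1 p.2) :=
    Finset.measurable_fun_prod _ fun k _ => measurable_const.min (F.measurable_ρ k)
  exact h

/-- The delayed acceptance kernel `P̃`. -/
def Factorisation.kernel [SigmaFinite ν] {M : MHData ν} {d : ℕ} (F : Factorisation M d) :
    Kernel X X :=
  acceptKernel ν M.q F.accept M.measurable_q F.measurable_accept

instance [SigmaFinite ν] {M : MHData ν} {d : ℕ} (F : Factorisation M d) :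
    IsMarkovKernel F.kernel :=
  acceptKernel_isMarkovKernel ν _ _ _ _ M.lintegral_q fun _ _ =>
    Finset.prod_le_one' fun _ _ => min_le_left _ _

end

end DelayedAcceptance

/-!
Both acceptance probabilities satisfy detailed balance, so both kernels are reversible. Where
`r ≥ 1`, at least one factor `ρ k` is at least `1` and the others are at least `c`, hence
`α̃ ≥ c ^ (d - 1) = c ^ (d - 1) α`; by detailed balance the bound `α̃ ≥ c ^ (d - 1) α` carries over
to `r < 1` (`Factorisation.pow_mul_accept_le`). Since the two kernels differ in the acceptance
probability only, this compares the Dirichlet forms, and with them the spectral gaps.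

For the asymptotic variance, let `T` be the operator of the kernel on `L²(π)`, a symmetric
contraction, and let `c k = ⟪f, T ^ k f⟫` be the autocovariances of the centred `f`. The scaled
variances are the Fejér means of `c` (`scaledVariance_eq`). Symmetry makes `c (2 * j)` nonnegative
and antitone and `c (2 * j) + c (2 * j + 1)` nonnegative, so the partial sums along even indices
increase. If they are unbounded, the Fejér means tend to infinity. If they are bounded, the
sums of two consecutive partial sums converge, to `L` say, and then the Fejér means converge to
`L - c 0` and twice the Abel sums `∑ c k x ^ k` converge to `L` as `x ↑ 1`
(`IsReversibleSeq.tendsto_of_bddAbove`). No spectral theorem is needed.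

The Abel sum equals `⟪f, (1 - x T)⁻¹ f⟫ = sup_g (2 ⟪f, g⟫ - ⟪g, (1 - x T) g⟫)`, where
`⟪g, (1 - x T) g⟫ = (1 - x) ‖g‖² + x ⟪g, (1 - T) g⟫` and `⟪g, (1 - T) g⟫` is the Dirichlet form.
So a lower bound `ϱ` on the ratio of the Dirichlet forms gives the upper bound `ϱ⁻¹` on the ratio
of the Abel sums (`abel_sum_le`), and `x ↑ 1` gives the comparison of the asymptotic variances
(`asymptoticVariance_le`).
-/

namespace DelayedAcceptance

/-! ### Fejér means and Abel sums of autocovariance sequences -/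

section Sequences

variable {c : ℕ → ℝ}

theorem tendsto_of_tendsto_even_odd {α : Type*} {u : ℕ → α} {l : Filter α}
    (he : Tendsto (fun j => u (2 * j)) atTop l)
    (ho : Tendsto (fun j => u (2 * j + 1)) atTop l) : Tendsto u atTop l := by
  intro s hs
  obtain ⟨a, ha⟩ := eventually_atTop.1 (he hs)
  obtain ⟨b, hb⟩ := eventually_atTop.1 (ho hs)
  refine eventually_atTop.2 ⟨2 * a + 2 * b, fun n hn => ?_⟩
  obtain ⟨j, rfl | rfl⟩ := n.even_or_odd'
  · exact ha j (by omega)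
  · exact hb j (by omega)

/-- The Fejér sum of `c` in terms of its partial sums: passing from `n` to `n + 1` adds a row and a
column, each of which is a partial sum. -/
theorem sum_range_dist_eq (c : ℕ → ℝ) (n : ℕ) :
    ∑ i ∈ Finset.range n, ∑ j ∈ Finset.range n, c (Nat.dist i j)
      = 2 * (∑ m ∈ Finset.range n, ∑ k ∈ Finset.range (m + 1), c k) - n * c 0 := by
  induction n with
  | zero => simp
  | succ n ih =>
    have hrow : ∑ j ∈ Finset.range n, c (Nat.dist n j)
        = ∑ k ∈ Finset.range n, c (k + 1) := by
      rw [← Finset.sum_range_reflect]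
      refine Finset.sum_congr rfl fun j hj => ?_
      rw [Finset.mem_range] at hj
      congr 1
      simp only [Nat.dist]
      omega
    have hcol : ∑ i ∈ Finset.range n, c (Nat.dist i n)
        = ∑ k ∈ Finset.range n, c (k + 1) := by
      simpa only [Nat.dist_comm] using hrow
    rw [Finset.sum_range_succ, Finset.sum_range_succ (fun m => ∑ k ∈ Finset.range (m + 1), c k)]
    simp_rw [Finset.sum_range_succ (fun j => c (Nat.dist _ j))]
    rw [Finset.sum_add_distrib, ih, hrow, hcol, Nat.dist_self, Finset.sum_range_succ' c n]
    push_cast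
    ring

/-- The three properties of the autocovariances `c k = ⟪f, T ^ k f⟫` of a reversible chain on
which the existence of the asymptotic variance rests. They hold for every symmetric contraction
`T`, see `isReversibleSeq_inner_pow`. -/
structure IsReversibleSeq (c : ℕ → ℝ) : Prop where
  antitone_even : ∀ j, c (2 * (j + 1)) ≤ c (2 * j)
  abs_odd_le : ∀ j, |c (2 * j + 1)| ≤ c (2 * j)

namespace IsReversibleSeq

theorem even_nonneg (h : IsReversibleSeq c) (j : ℕ) : 0 ≤ c (2 * j) :=
  (abs_nonneg _).trans (h.abs_odd_le j)

theorem even_le_zero (h : IsReversibleSeq c) (j : ℕ) : c (2 * j) ≤ c 0 :=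
  antitone_nat_of_succ_le (f := fun j => c (2 * j)) h.antitone_even (Nat.zero_le j)

theorem abs_le (h : IsReversibleSeq c) (k : ℕ) : |c k| ≤ c 0 := by
  obtain ⟨j, rfl | rfl⟩ := k.even_or_odd'
  · rw [abs_of_nonneg (h.even_nonneg j)]
    exact h.even_le_zero j
  · exact (h.abs_odd_le j).trans (h.even_le_zero j)

theorem summable_mul_pow (h : IsReversibleSeq c) {x : ℝ} (hx0 : 0 ≤ x) (hx1 : x < 1) :
    Summable fun k => c k * x ^ k := by
  refine Summable.of_norm_bounded ((summable_geometric_of_lt_one hx0 hx1).mul_left (c 0))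
    fun k => ?_
  rw [norm_mul, norm_pow, Real.norm_of_nonneg hx0]
  exact mul_le_mul_of_nonneg_right (h.abs_le k) (pow_nonneg hx0 k)

theorem sum_range_even (c : ℕ → ℝ) (j : ℕ) :
    ∑ k ∈ Finset.range (2 * j), c k
      = ∑ i ∈ Finset.range j, (c (2 * i) + c (2 * i + 1)) := by
  induction j with
  | zero => simp
  | succ j ih => rw [Nat.mul_succ, Finset.sum_range_succ, Finset.sum_range_succ, ih,
      Finset.sum_range_succ]; ring

theorem pair_nonneg (h : IsReversibleSeq c) (j : ℕ) : 0 ≤ c (2 * j) + c (2 * j + 1) := by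
  have := neg_abs_le (c (2 * j + 1))
  have := h.abs_odd_le j
  linarith

theorem monotone_sum_even (h : IsReversibleSeq c) :
    Monotone fun j => ∑ k ∈ Finset.range (2 * j), c k := by
  refine monotone_nat_of_le_succ fun j => ?_
  rw [sum_range_even, sum_range_even, Finset.sum_range_succ]
  linarith [h.pair_nonneg j]

theorem sum_odd (c : ℕ → ℝ) (j : ℕ) : ∑ k ∈ Finset.range (2 * j + 1), c k
    = ∑ k ∈ Finset.range (2 * j), c k + c (2 * j) := Finset.sum_range_succ _ _

theorem sum_nonneg (h : IsReversibleSeq c) (m : ℕ) : 0 ≤ ∑ k ∈ Finset.range m, c k := by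
  have he : ∀ j, 0 ≤ ∑ k ∈ Finset.range (2 * j), c k := fun j => by
    simpa using h.monotone_sum_even (Nat.zero_le j)
  obtain ⟨j, rfl | rfl⟩ := m.even_or_odd'
  · exact he j
  · rw [sum_odd]
    exact add_nonneg (he j) (h.even_nonneg j)

/-- The sums `S m = ∑ k < m, c k` may oscillate between even and odd `m`, by the limit of
`c (2 * j)`, which is the mass of the spectral measure at `-1`. Adding two consecutive sums
removes the oscillation. -/
theorem exists_tendsto_of_bddAbove (h : IsReversibleSeq c)
    (hb : BddAbove (Set.range fun j => ∑ k ∈ Finset.range (2 * j), c k)) :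
    ∃ L, Tendsto (fun m => ∑ k ∈ Finset.range m, c k + ∑ k ∈ Finset.range (m + 1), c k)
      atTop (𝓝 L) := by
  have hS := tendsto_atTop_ciSup h.monotone_sum_even hb
  set D := ⨆ j, ∑ k ∈ Finset.range (2 * j), c k
  have hl := tendsto_atTop_ciInf (f := fun j => c (2 * j))
    (antitone_nat_of_succ_le h.antitone_even) ⟨0, by rintro _ ⟨j, rfl⟩; exact h.even_nonneg j⟩
  set l := ⨅ j, c (2 * j)
  refine ⟨D + (D + l), tendsto_of_tendsto_even_odd ?_ ?_⟩
  · refine (hS.add (hS.add hl)).congr fun j => ?_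
    rw [sum_odd]
  · have hS' := hS.comp (tendsto_add_atTop_nat 1)
    have := (hS'.add (hS.add hl)).congr (f₂ := fun j => ∑ k ∈ Finset.range (2 * j + 1), c k
      + ∑ k ∈ Finset.range (2 * j + 1 + 1), c k) fun j => ?_
    · exact this
    · simp only [Function.comp_apply, Nat.mul_succ]
      rw [sum_odd]
      ring

theorem tendsto_sum_of_not_bddAbove (h : IsReversibleSeq c)
    (hb : ¬ BddAbove (Set.range fun j => ∑ k ∈ Finset.range (2 * j), c k)) :
    Tendsto (fun m => ∑ k ∈ Finset.range m, c k) atTop atTop := by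
  have hS := tendsto_atTop_atTop_of_monotone' h.monotone_sum_even hb
  refine tendsto_of_tendsto_even_odd hS (tendsto_atTop_mono (fun j => ?_) hS)
  rw [sum_odd]
  linarith [h.even_nonneg j]

/-- If the partial sums are bounded, the Fejér means and the Abel sums of `c` both converge,
to limits which determine each other. -/
theorem tendsto_of_bddAbove (h : IsReversibleSeq c)
    (hb : BddAbove (Set.range fun j => ∑ k ∈ Finset.range (2 * j), c k)) :
    ∃ L, Tendsto (fun n : ℕ => (n : ℝ)⁻¹ *
        ∑ i ∈ Finset.range n, ∑ j ∈ Finset.range n, c (Nat.dist i j)) atTop (𝓝 (L - c 0)) ∧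
      Tendsto (fun x => 2 * ∑' k, c k * x ^ k) (𝓝[<] 1) (𝓝 L) := by
  obtain ⟨L, hL⟩ := h.exists_tendsto_of_bddAbove hb
  refine ⟨L, ?_, ?_⟩
  · -- the Fejér mean is the Cesàro mean of `S m + S (m + 1)` up to `S n / n`
    obtain ⟨K, hK⟩ := hb
    have hK' : ∀ n, ∑ k ∈ Finset.range n, c k ≤ K + c 0 := fun n => by
      have h0 := h.even_nonneg 0
      obtain ⟨j, rfl | rfl⟩ := n.even_or_odd'
      · exact (hK ⟨j, rfl⟩).trans (by simpa using h0)
      · rw [sum_odd]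
        exact add_le_add (hK ⟨j, rfl⟩) (h.even_le_zero j)
    have hlim : Tendsto (fun n : ℕ => (n : ℝ)⁻¹ * ∑ k ∈ Finset.range n, c k) atTop (𝓝 0) := by
      have hz : Tendsto (fun n : ℕ => (n : ℝ)⁻¹ * (K + c 0)) atTop (𝓝 0) := by
        simpa using tendsto_inv_atTop_nhds_zero_nat.mul_const (K + c 0)
      refine squeeze_zero (fun n => mul_nonneg (by positivity) (h.sum_nonneg n)) (fun n => ?_) hz
      exact mul_le_mul_of_nonneg_left (hK' n) (by positivity)
    have hfin := (hL.cesaro.add hlim).sub_const (c 0)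
    rw [add_zero] at hfin
    refine hfin.congr' ?_
    filter_upwards [eventually_gt_atTop 0] with n hn
    have hn' : (n : ℝ) ≠ 0 := by positivity
    rw [sum_range_dist_eq, Finset.sum_add_distrib]
    have htel : ∑ m ∈ Finset.range n, ∑ k ∈ Finset.range m, c k + ∑ k ∈ Finset.range n, c k
        = ∑ m ∈ Finset.range n, ∑ k ∈ Finset.range (m + 1), c k := by
      rw [← Finset.sum_range_succ (fun m => ∑ k ∈ Finset.range m, c k), Finset.sum_range_succ']
      simp
    rw [← htel]
    field_simp
    ring
  · -- `S m + S (m + 1)` are the partial sums of the power series `(1 + x) ∑ c k x ^ k`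
    let f : ℕ → ℝ := fun k => c k + if k = 0 then 0 else c (k - 1)
    have hf : ∀ m, ∑ k ∈ Finset.range (m + 1), f k
        = ∑ k ∈ Finset.range m, c k + ∑ k ∈ Finset.range (m + 1), c k := fun m => by
      simp only [f, Finset.sum_add_distrib]
      rw [Finset.sum_range_succ' (fun k => if k = 0 then 0 else c (k - 1))]
      simp [add_comm]
    have hfl : Tendsto (fun n => ∑ k ∈ Finset.range n, f k) atTop (𝓝 L) := by
      rw [← tendsto_add_atTop_iff_nat 1]
      simpa only [hf] using hL
    have habel := Real.tendsto_tsum_powerSeries_nhdsWithin_lt hfl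
    have hx1 : Tendsto (fun x : ℝ => 2 * (1 + x)⁻¹) (𝓝[<] 1) (𝓝 (2 * (1 + 1)⁻¹)) := by
      refine Tendsto.mono_left ?_ nhdsWithin_le_nhds
      refine Tendsto.const_mul _ (Tendsto.inv₀ (tendsto_const_nhds.add tendsto_id) (by norm_num))
    have := hx1.mul habel
    norm_num at this
    refine this.congr' ?_
    have hx : ∀ᶠ x : ℝ in 𝓝[<] 1, 0 < x ∧ x < 1 := by
      filter_upwards [Ioo_mem_nhdsLT (show (0 : ℝ) < 1 by norm_num)] with x hx using hx
    filter_upwards [hx] with x hx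
    have hs := h.summable_mul_pow hx.1.le hx.2
    have hs2 : HasSum (fun k => (if k = 0 then 0 else c (k - 1)) * x ^ k)
        (x * ∑' k, c k * x ^ k) := by
      rw [← hasSum_nat_add_iff' 1]
      simp only [Finset.range_one, Finset.sum_singleton, if_true, zero_mul, sub_zero,
        Nat.add_eq_zero_iff, one_ne_zero, and_false, if_false, Nat.add_sub_cancel]
      refine (hs.hasSum.mul_left x).congr_fun fun k => ?_
      ring
    have hsum : ∑' k, f k * x ^ k = (1 + x) * ∑' k, c k * x ^ k := by
      have := (hs.hasSum.add hs2).tsum_eq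
      simp only [f, add_mul]
      rw [this, one_mul]
    rw [hsum]
    have : 1 + x ≠ 0 := by linarith [hx.1]
    field_simp

/-- If the partial sums are unbounded, they tend to infinity, and so do the Fejér means. -/
theorem tendsto_atTop_of_not_bddAbove (h : IsReversibleSeq c)
    (hb : ¬ BddAbove (Set.range fun j => ∑ k ∈ Finset.range (2 * j), c k)) :
    Tendsto (fun n : ℕ => (n : ℝ)⁻¹ *
        ∑ i ∈ Finset.range n, ∑ j ∈ Finset.range n, c (Nat.dist i j)) atTop atTop := by
  have hS := (tendsto_sum_of_not_bddAbove h hb).comp (tendsto_add_atTop_nat 1)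
  refine tendsto_atTop.2 fun K => ?_
  -- truncate the partial sums at `K'`, so that the Cesàro theorem applies
  set K' := |K| + c 0 + 1 with hK'
  have hmin : Tendsto (fun m => min (∑ k ∈ Finset.range (m + 1), c k) K') atTop (𝓝 K') := by
    refine tendsto_const_nhds.congr' ?_
    filter_upwards [hS.eventually_ge_atTop K'] with m hm
    exact (min_eq_right hm).symm
  have h0 : 0 ≤ c 0 := h.even_nonneg 0
  have hlt : (K + c 0) / 2 < K' := by
    have := le_abs_self K
    have := abs_nonneg K
    rw [hK']
    linarith
  filter_upwards [hmin.cesaro.eventually_const_lt hlt, eventually_gt_atTop 0] with n hn hn0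
  have hn' : (n : ℝ) ≠ 0 := by positivity
  have hle : (n : ℝ)⁻¹ * ∑ m ∈ Finset.range n, min (∑ k ∈ Finset.range (m + 1), c k) K'
      ≤ (n : ℝ)⁻¹ * ∑ m ∈ Finset.range n, ∑ k ∈ Finset.range (m + 1), c k :=
    mul_le_mul_of_nonneg_left (Finset.sum_le_sum fun _ _ => min_le_left _ _) (by positivity)
  rw [sum_range_dist_eq]
  have : (n : ℝ)⁻¹ * (2 * (∑ m ∈ Finset.range n, ∑ k ∈ Finset.range (m + 1), c k) - n * c 0)
      = 2 * ((n : ℝ)⁻¹ * ∑ m ∈ Finset.range n, ∑ k ∈ Finset.range (m + 1), c k) - c 0 := by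
    field_simp
  rw [this]
  linarith

/-- Bounded Abel sums force bounded partial sums, because grouping `c` in pairs makes all the
terms nonnegative. -/
theorem bddAbove_of_abel (h : IsReversibleSeq c) {K : ℝ}
    (hK : ∀ᶠ x in 𝓝[<] (1 : ℝ), ∑' k, c k * x ^ k ≤ K) :
    BddAbove (Set.range fun j => ∑ k ∈ Finset.range (2 * j), c k) := by
  refine ⟨K, ?_⟩
  rintro _ ⟨j, rfl⟩
  have hlim : Tendsto (fun x : ℝ => ∑ k ∈ Finset.range (2 * j), c k * x ^ k) (𝓝[<] 1)
      (𝓝 (∑ k ∈ Finset.range (2 * j), c k * 1 ^ k)) := by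
    refine Tendsto.mono_left (Continuous.tendsto ?_ 1) nhdsWithin_le_nhds
    fun_prop
  simp only [one_pow, mul_one] at hlim
  refine le_of_tendsto hlim ?_
  filter_upwards [hK, Ioo_mem_nhdsLT (show (0 : ℝ) < 1 by norm_num)] with x hx hx01
  refine le_trans ?_ hx
  -- along even indices the partial sums of the Abel series increase
  have hmono : Monotone fun j => ∑ k ∈ Finset.range (2 * j), c k * x ^ k := by
    refine monotone_nat_of_le_succ fun i => ?_
    rw [sum_range_even (fun k => c k * x ^ k), sum_range_even (fun k => c k * x ^ k),
      Finset.sum_range_succ]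
    have h1 := neg_abs_le (c (2 * i + 1))
    have h2 := h.abs_odd_le i
    have h3 : 0 ≤ c (2 * i) + c (2 * i + 1) * x := by
      nlinarith [abs_nonneg (c (2 * i + 1)), hx01.1, hx01.2]
    have : 0 ≤ (c (2 * i) + c (2 * i + 1) * x) * x ^ (2 * i) :=
      mul_nonneg h3 (pow_nonneg hx01.1.le _)
    have e : (c (2 * i) + c (2 * i + 1) * x) * x ^ (2 * i)
      = c (2 * i) * x ^ (2 * i) + c (2 * i + 1) * x ^ (2 * i + 1) := by ring
    linarith
  exact hmono.ge_of_tendsto ((h.summable_mul_pow hx01.1.le hx01.2).hasSum.tendsto_sum_nat.comp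
    (tendsto_id.const_mul_atTop' (by norm_num : 0 < 2))) j

end IsReversibleSeq

end Sequences

/-! ### Symmetric contractions of a Hilbert space -/

section Contractions

variable {H : Type*} [NormedAddCommGroup H] [InnerProductSpace ℝ H]

open scoped InnerProductSpace

theorem norm_pow_le {T : H →L[ℝ] H} (hT : ‖T‖ ≤ 1) (k : ℕ) : ‖T ^ k‖ ≤ 1 := by
  induction k with
  | zero => exact ContinuousLinearMap.norm_id_le
  | succ k ih =>
    rw [pow_succ]
    exact (norm_mul_le _ _).trans (mul_le_one₀ ih (norm_nonneg _) hT)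

theorem inner_pow_left {T : H →L[ℝ] H} (hs : ∀ u v, ⟪T u, v⟫_ℝ = ⟪u, T v⟫_ℝ) (k : ℕ) (u v : H) :
    ⟪(T ^ k) u, v⟫_ℝ = ⟪u, (T ^ k) v⟫_ℝ := by
  induction k generalizing u v with
  | zero => simp
  | succ k ih =>
    rw [pow_succ, mul_apply_eq_comp, ih, hs, ← mul_apply_eq_comp,
      ← pow_succ', pow_succ]

theorem isReversibleSeq_inner_pow {T : H →L[ℝ] H} (hT : ‖T‖ ≤ 1)
    (hs : ∀ u v, ⟪T u, v⟫_ℝ = ⟪u, T v⟫_ℝ) (f : H) :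
    IsReversibleSeq fun k => ⟪f, (T ^ k) f⟫_ℝ := by
  have hc : ∀ u, ‖T u‖ ≤ ‖u‖ := fun u => by
    simpa using T.le_of_opNorm_le hT u
  have heven : ∀ j, ⟪f, (T ^ (2 * j)) f⟫_ℝ = ‖(T ^ j) f‖ ^ 2 := fun j => by
    rw [two_mul, pow_add, mul_apply_eq_comp, ← inner_pow_left hs,
      real_inner_self_eq_norm_sq]
  refine ⟨fun j => ?_, fun j => ?_⟩
  · simp only [heven, pow_succ' T, mul_apply_eq_comp]
    exact pow_le_pow_left₀ (norm_nonneg _) (hc _) 2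
  · have hodd : ⟪f, (T ^ (2 * j + 1)) f⟫_ℝ = ⟪(T ^ j) f, T ((T ^ j) f)⟫_ℝ := by
      rw [inner_pow_left hs, ← mul_apply_eq_comp, ← mul_apply_eq_comp,
        mul_assoc, ← pow_succ', ← pow_add]
      congr 3
      ring
    simp only [heven, hodd]
    refine (abs_real_inner_le_norm _ _).trans ?_
    rw [sq]
    exact mul_le_mul_of_nonneg_left (hc _) (norm_nonneg _)

theorem one_sub_inner_nonneg {T : H →L[ℝ] H} (hT : ‖T‖ ≤ 1) {x : ℝ} (hx0 : 0 ≤ x)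
    (hx1 : x ≤ 1) (u : H) : 0 ≤ ⟪u, u - x • T u⟫_ℝ := by
  have hc : ‖T u‖ ≤ ‖u‖ := by simpa using T.le_of_opNorm_le hT u
  rw [inner_sub_right, inner_smul_right, real_inner_self_eq_norm_sq]
  have h1 := real_inner_le_norm u (T u)
  have h2 : ‖u‖ * ‖T u‖ ≤ ‖u‖ ^ 2 := by
    rw [sq]; exact mul_le_mul_of_nonneg_left hc (norm_nonneg _)
  nlinarith [sq_nonneg ‖u‖]

variable [CompleteSpace H]

/-- The Neumann series: `g = (1 - x T)⁻¹ f` exists for `x < 1`, and `⟪f, g⟫` is the Abel sum of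
the autocovariances. -/
theorem exists_resolvent {T : H →L[ℝ] H} (hT : ‖T‖ ≤ 1) {x : ℝ} (hx0 : 0 ≤ x) (hx1 : x < 1)
    (f : H) : ∃ g, g - x • T g = f ∧ ⟪f, g⟫_ℝ = ∑' k, ⟪f, (T ^ k) f⟫_ℝ * x ^ k := by
  have hs : Summable fun k => x ^ k • (T ^ k) f := by
    refine Summable.of_norm_bounded ((summable_geometric_of_lt_one hx0 hx1).mul_right ‖f‖)
      fun k => ?_
    rw [norm_smul, norm_pow, Real.norm_of_nonneg hx0]
    refine mul_le_mul_of_nonneg_left ?_ (pow_nonneg hx0 k)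
    simpa using (T ^ k).le_of_opNorm_le (norm_pow_le hT k) f
  refine ⟨∑' k, x ^ k • (T ^ k) f, ?_, ?_⟩
  · have hT1 : x • T (∑' k, x ^ k • (T ^ k) f) = ∑' k, x ^ (k + 1) • (T ^ (k + 1)) f := by
      have hs' : Summable fun k => T (x ^ k • (T ^ k) f) := hs.map T T.continuous
      rw [T.map_tsum hs, ← hs'.tsum_const_smul x]
      refine tsum_congr fun k => ?_
      simp only [map_smul, smul_smul, ← pow_succ', ← mul_apply_eq_comp]
    rw [hT1, hs.tsum_eq_zero_add]
    simp
  · have := (innerSL ℝ f).map_tsum hs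
    simp only [innerSL_apply_apply] at this
    rw [this]
    refine tsum_congr fun k => ?_
    rw [inner_smul_right, mul_comm]

/-- The Abel sum `⟪f, (1 - x T)⁻¹ f⟫` is the supremum over `g` of `2 ⟪f, g⟫ - ⟪g, (1 - x T) g⟫`.
Hence a comparison of the Dirichlet forms of two symmetric contractions gives the reverse
comparison of the Abel sums. -/
theorem abel_sum_le {T T' : H →L[ℝ] H} (hT : ‖T‖ ≤ 1) (hT' : ‖T'‖ ≤ 1)
    (hs : ∀ u v, ⟪T u, v⟫_ℝ = ⟪u, T v⟫_ℝ) {ϱ : ℝ} (hϱ0 : 0 < ϱ) (hϱ1 : ϱ ≤ 1)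
    (hle : ∀ u, ϱ * ⟪u, u - T u⟫_ℝ ≤ ⟪u, u - T' u⟫_ℝ) (f : H) {x : ℝ} (hx0 : 0 ≤ x)
    (hx1 : x < 1) :
    ∑' k, ⟪f, (T' ^ k) f⟫_ℝ * x ^ k ≤ ϱ⁻¹ * ∑' k, ⟪f, (T ^ k) f⟫_ℝ * x ^ k := by
  obtain ⟨g, hg, hgs⟩ := exists_resolvent hT hx0 hx1 f
  obtain ⟨g', hg', hgs'⟩ := exists_resolvent hT' hx0 hx1 f
  rw [← hgs, ← hgs']
  have h1 : ϱ * ⟪g', g' - x • T g'⟫_ℝ ≤ ⟪g', f⟫_ℝ := by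
    have h0 : ⟪g', f⟫_ℝ = ⟪g', g' - x • T' g'⟫_ℝ := by rw [hg']
    rw [h0]
    have h := mul_le_mul_of_nonneg_left (hle g') hx0
    simp only [inner_sub_right, inner_smul_right] at h ⊢
    have h0 := mul_nonneg (mul_nonneg (sub_nonneg.2 hx1.le) (sub_nonneg.2 hϱ1))
      (real_inner_self_nonneg (x := g'))
    linarith
  -- complete the square around the maximiser `ϱ⁻¹ g`
  have h2 := one_sub_inner_nonneg hT hx0 hx1.le (g' - ϱ⁻¹ • g)
  have h3 : g' - ϱ⁻¹ • g - x • T (g' - ϱ⁻¹ • g) = (g' - x • T g') - ϱ⁻¹ • f := by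
    rw [← hg, map_sub, map_smul]
    module
  have h4 : ⟪g, g' - x • T g'⟫_ℝ = ⟪f, g'⟫_ℝ := by
    rw [← hg, inner_sub_right, inner_sub_left, inner_smul_right, inner_smul_left, hs]
    simp
  rw [h3] at h2
  generalize g' - x • T g' = p at h1 h2 h4
  rw [inner_sub_left, inner_sub_right, inner_sub_right, inner_smul_left, inner_smul_left,
    inner_smul_right, inner_smul_right, h4] at h2
  simp only [conj_trivial] at h2
  have h5 := mul_nonneg hϱ0.le h2
  have h6 : ϱ * (⟪g', p⟫_ℝ - ϱ⁻¹ * ⟪g', f⟫_ℝ - (ϱ⁻¹ * ⟪f, g'⟫_ℝ - ϱ⁻¹ * (ϱ⁻¹ * ⟪g, f⟫_ℝ)))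
      = ϱ * ⟪g', p⟫_ℝ - ⟪g', f⟫_ℝ - ⟪f, g'⟫_ℝ + ϱ⁻¹ * ⟪g, f⟫_ℝ := by
    field_simp
    ring
  have h7 := real_inner_comm g f
  have h8 := real_inner_comm g' f
  rw [h7]
  linarith

end Contractions

/-! ### The operator of a Markov kernel on square integrable functions -/

open scoped InnerProductSpace

theorem integral_comp_measurePreserving {α β : Type*} [MeasurableSpace α] [MeasurableSpace β]
    {μ : Measure α} {ν : Measure β} {φ : α → β} (h : MeasurePreserving φ μ ν) {g : β → ℝ}
    (hg : Measurable g) : ∫ x, g (φ x) ∂μ = ∫ y, g y ∂ν := by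
  rw [← h.map_eq, integral_map h.measurable.aemeasurable hg.aestronglyMeasurable]

theorem integrable_integral_of_compProd {α β : Type*} [MeasurableSpace α] [MeasurableSpace β]
    {μ : Measure α} {κ : Kernel α β} [SFinite μ] [IsSFiniteKernel κ] {f : α × β → ℝ}
    (hf : Integrable f (μ ⊗ₘ κ)) : Integrable (fun x => ∫ y, f (x, y) ∂(κ x)) μ :=
  Integrable.integral_compProd (κ := Kernel.const Unit μ) (η := Kernel.prodMkLeft Unit κ)
    (a := ()) hf

section MarkovOperator

variable {X : Type*} [MeasurableSpace X] {μ : Measure X} {P : Kernel X X}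

theorem measurePreserving_fst_compProd [SFinite μ] [IsMarkovKernel P] :
    MeasurePreserving Prod.fst (μ ⊗ₘ P) μ :=
  ⟨measurable_fst, Measure.fst_compProd μ P⟩

theorem measurePreserving_snd_compProd [SFinite μ] [IsSFiniteKernel P] (hP : P.Invariant μ) :
    MeasurePreserving Prod.snd (μ ⊗ₘ P) μ :=
  ⟨measurable_snd, (Measure.snd_compProd μ P).trans hP⟩

theorem measurePreserving_swap_compProd [IsProbabilityMeasure μ] [IsMarkovKernel P]
    (hP : P.IsReversible μ) : MeasurePreserving Prod.swap (μ ⊗ₘ P) (μ ⊗ₘ P) := by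
  refine ⟨measurable_swap, ?_⟩
  have : IsProbabilityMeasure ((μ ⊗ₘ P).map Prod.swap) :=
    Measure.isProbabilityMeasure_map measurable_swap.aemeasurable
  refine Measure.ext_prod fun {A B} hA hB => ?_
  rw [Measure.map_apply measurable_swap (hA.prod hB), Set.preimage_swap_prod,
    Measure.compProd_apply_prod hB hA, Measure.compProd_apply_prod hA hB, hP hB hA]

variable [IsProbabilityMeasure μ] [IsMarkovKernel P]

/-- The operator `f ↦ (x ↦ ∫ f(y) P(x,dy))` on `L²(μ)`, for an invariant `μ`. It is encoded as
`U* V`, where the isometries `U` and `V` embed `L²(μ)` into `L²(μ(dx) P(x,dy))` as functions of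
`x` and of `y`. -/
noncomputable def markovOperator (hP : P.Invariant μ) : Lp ℝ 2 μ →L[ℝ] Lp ℝ 2 μ :=
  ContinuousLinearMap.adjoint (Lp.compMeasurePreservingₗᵢ ℝ (E := ℝ) (p := 2) Prod.fst
      (measurePreserving_fst_compProd (μ := μ) (P := P))).toContinuousLinearMap
    ∘L (Lp.compMeasurePreservingₗᵢ ℝ (E := ℝ) (p := 2) Prod.snd
      (measurePreserving_snd_compProd hP)).toContinuousLinearMap

theorem norm_markovOperator_le (hP : P.Invariant μ) : ‖markovOperator hP‖ ≤ 1 := by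
  refine (ContinuousLinearMap.opNorm_comp_le _ _).trans ?_
  rw [LinearIsometryEquiv.norm_map]
  exact mul_le_one₀ (LinearIsometry.norm_toContinuousLinearMap_le _) (norm_nonneg _)
    (LinearIsometry.norm_toContinuousLinearMap_le _)

theorem inner_markovOperator (hP : P.Invariant μ) (f g : Lp ℝ 2 μ) :
    ⟪f, markovOperator hP g⟫_ℝ = ∫ z, f z.1 * g z.2 ∂(μ ⊗ₘ P) := by
  rw [markovOperator, ContinuousLinearMap.comp_apply, ContinuousLinearMap.adjoint_inner_right,
    L2.inner_def]
  refine integral_congr_ae ?_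
  filter_upwards [Lp.coeFn_compMeasurePreserving f
    (measurePreserving_fst_compProd (μ := μ) (P := P)),
    Lp.coeFn_compMeasurePreserving g (measurePreserving_snd_compProd hP)] with z h1 h2
  simp only [LinearIsometry.coe_toContinuousLinearMap]
  change ⟪(Lp.compMeasurePreserving Prod.fst _ f : X × X → ℝ) z,
    (Lp.compMeasurePreserving Prod.snd _ g : X × X → ℝ) z⟫_ℝ = _
  rw [h1, h2]
  simp [mul_comm]

theorem markovOperator_symm (hP : P.IsReversible μ) (f g : Lp ℝ 2 μ) :
    ⟪markovOperator hP.invariant f, g⟫_ℝ = ⟪f, markovOperator hP.invariant g⟫_ℝ := by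
  rw [real_inner_comm, inner_markovOperator, inner_markovOperator,
    ← (measurePreserving_swap_compProd hP).integral_comp
      MeasurableEquiv.prodComm.measurableEmbedding]
  simp [mul_comm]

theorem memLp_comp_fst (f : Lp ℝ 2 μ) : MemLp (fun z : X × X => f z.1) 2 (μ ⊗ₘ P) :=
  (Lp.memLp f).comp_measurePreserving measurePreserving_fst_compProd

theorem memLp_comp_snd (hP : P.Invariant μ) (f : Lp ℝ 2 μ) :
    MemLp (fun z : X × X => f z.2) 2 (μ ⊗ₘ P) :=
  (Lp.memLp f).comp_measurePreserving (measurePreserving_snd_compProd hP)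

/-- The operator defined by the adjoint is indeed integration against the kernel. The two sides
are compared by testing against indicators. -/
theorem markovOperator_ae_eq (hP : P.Invariant μ) (f : Lp ℝ 2 μ) :
    markovOperator hP f =ᵐ[μ] fun x => ∫ y, f y ∂(P x) := by
  have hint : Integrable (fun z : X × X => f z.2) (μ ⊗ₘ P) :=
    (memLp_comp_snd hP f).integrable one_le_two
  refine Integrable.ae_eq_of_forall_setIntegral_eq _ _
    ((Lp.memLp _).integrable one_le_two) (integrable_integral_of_compProd hint) fun s hs _ => ?_
  have h1 := L2.inner_indicatorConstLp_one (𝕜 := ℝ) hs (measure_ne_top μ s) (markovOperator hP f)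
  rw [← h1, inner_markovOperator, ← integral_indicator hs]
  have h2 : (fun z : X × X => (indicatorConstLp 2 hs (measure_ne_top μ s) (1 : ℝ) : X → ℝ) z.1
      * f z.2) =ᵐ[μ ⊗ₘ P] fun z => s.indicator (fun _ => (1 : ℝ)) z.1 * f z.2 := by
    have := measurePreserving_fst_compProd (μ := μ) (P := P).quasiMeasurePreserving.ae_eq_comp
      (indicatorConstLp_coeFn (p := 2) (hs := hs) (hμs := measure_ne_top μ s) (c := (1 : ℝ)))
    filter_upwards [this] with z hz
    simp only [Function.comp_apply] at hz
    rw [hz]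
  rw [integral_congr_ae h2, Measure.integral_compProd]
  · refine integral_congr_ae (ae_of_all _ fun x => ?_)
    by_cases hx : x ∈ s <;> simp [hx]
  · refine (hint.indicator (s := Prod.fst ⁻¹' s) (measurable_fst hs)).congr
      (ae_of_all _ fun z => ?_)
    by_cases hx : z.1 ∈ s <;> simp [hx]

theorem dirichletForm_coe (hP : P.Invariant μ) (f : Lp ℝ 2 μ) :
    dirichletForm P μ f = ENNReal.ofReal ⟪f, f - markovOperator hP f⟫_ℝ := by
  have hm : Measurable (f : X → ℝ) := (Lp.stronglyMeasurable f).measurable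
  have h1 := memLp_comp_fst (P := P) f
  have h2 := memLp_comp_snd hP f
  have hsq : Measurable fun z : X × X => ENNReal.ofReal ((f z.1 - f z.2) ^ 2) := by fun_prop
  have hint : Integrable (fun z : X × X => (f z.1 - f z.2) ^ 2) (μ ⊗ₘ P) :=
    (h1.sub h2).integrable_sq
  rw [dirichletForm, ← Measure.lintegral_compProd hsq,
    ← ofReal_integral_eq_lintegral_ofReal hint (ae_of_all _ fun z => sq_nonneg _)]
  have e1 : ∫ z, f z.1 ^ 2 ∂(μ ⊗ₘ P) = ⟪f, f⟫_ℝ := by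
    rw [L2.inner_def, integral_comp_measurePreserving measurePreserving_fst_compProd
      (g := fun x => f x ^ 2) (by fun_prop)]
    simp [sq]
  have e2 : ∫ z, f z.2 ^ 2 ∂(μ ⊗ₘ P) = ⟪f, f⟫_ℝ := by
    rw [L2.inner_def, integral_comp_measurePreserving (measurePreserving_snd_compProd hP)
      (g := fun x => f x ^ 2) (by fun_prop)]
    simp [sq]
  have e3 : ∫ z, (f z.1 - f z.2) ^ 2 ∂(μ ⊗ₘ P) = 2 * ⟪f, f - markovOperator hP f⟫_ℝ := by
    have : ∀ z : X × X, (f z.1 - f z.2) ^ 2 = f z.1 ^ 2 + f z.2 ^ 2 - 2 * (f z.1 * f z.2) :=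
      fun z => by ring
    have i1 : Integrable (fun z : X × X => f z.1 ^ 2) (μ ⊗ₘ P) := h1.integrable_sq
    have i2 : Integrable (fun z : X × X => f z.2 ^ 2) (μ ⊗ₘ P) := h2.integrable_sq
    have i3 : Integrable (fun z : X × X => f z.1 * f z.2) (μ ⊗ₘ P) := h1.integrable_mul h2
    have i12 : Integrable (fun z : X × X => f z.1 ^ 2 + f z.2 ^ 2) (μ ⊗ₘ P) := i1.add i2
    simp_rw [this]
    rw [integral_sub i12 (i3.const_mul 2), integral_add i1 i2, integral_const_mul, e1,
      e2, ← inner_markovOperator hP, inner_sub_right]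
    ring
  rw [e3, ENNReal.ofReal_mul zero_le_two, ← mul_assoc]
  simp [ENNReal.inv_mul_cancel]

theorem dirichletForm_congr (hP : P.Invariant μ) {f g : X → ℝ} (hfg : f =ᵐ[μ] g) :
    dirichletForm P μ f = dirichletForm P μ g := by
  have h : ∀ᵐ x ∂μ, ∀ᵐ y ∂(P x), f y = g y :=
    Measure.ae_ae_of_ae_compProd ((measurePreserving_snd_compProd hP).quasiMeasurePreserving.ae hfg)
  rw [dirichletForm, dirichletForm]
  congr 1
  refine lintegral_congr_ae ?_
  filter_upwards [hfg, h] with x hx hy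
  refine lintegral_congr_ae ?_
  filter_upwards [hy] with y hy
  rw [hx, hy]

end MarkovOperator

/-! ### The stationary chain -/

section Chain

variable {X : Type*} [MeasurableSpace X] {μ : Measure X} {P : Kernel X X}
  [IsProbabilityMeasure μ] [IsMarkovKernel P]

instance : IsProbabilityMeasure (chainLaw P μ) := by
  unfold chainLaw; infer_instance

/-- The Markov property at time `n`: given the first `n + 1` states, the next state has law `P`
at the current one. -/
theorem map_chainLaw_succ (n : ℕ) :
    (chainLaw P μ).map (Preorder.frestrictLe n) ⊗ₘ
        P.comap (fun h : (i : Finset.Iic n) → X => h ⟨n, Finset.mem_Iic.2 le_rfl⟩)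
          (measurable_pi_apply _)
      = (chainLaw P μ).map fun w => (Preorder.frestrictLe (π := fun _ => X) n w, w (n + 1)) :=
  Kernel.map_frestrictLe_trajMeasure_compProd_eq_map_trajMeasure

theorem map_chainLaw_zero {X : Type*} [MeasurableSpace X] {μ : Measure X} {P : Kernel X X}
    [IsMarkovKernel P] : (chainLaw P μ).map (fun w => w 0) = μ := by
  have h : (fun w : ℕ → X => w 0) = (fun u : (i : Finset.Iic 0) → X =>
      u ⟨0, Finset.mem_Iic.2 le_rfl⟩) ∘ Preorder.frestrictLe (π := fun _ => X) 0 := rfl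
  rw [h, ← Measure.map_map (by fun_prop) (by fun_prop), chainLaw, Kernel.trajMeasure,
    Measure.map_comp _ _ (by fun_prop), Kernel.traj_map_frestrictLe, Kernel.partialTraj_self,
    Measure.id_comp, Measure.map_map (by fun_prop) (by fun_prop)]
  exact Measure.map_id

/-- The chain started from an invariant law is stationary. -/
theorem measurePreserving_eval_chainLaw (hP : P.Invariant μ) (n : ℕ) :
    MeasurePreserving (fun w : ℕ → X => w n) (chainLaw P μ) μ := by
  refine ⟨measurable_pi_apply n, ?_⟩
  induction n with
  | zero => exact map_chainLaw_zero
  | succ n ih =>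
    have h := congrArg (Measure.map Prod.snd) (map_chainLaw_succ (P := P) (μ := μ) n)
    rw [Measure.map_map measurable_snd (by fun_prop)] at h
    refine Eq.trans h.symm ?_
    ext s hs
    rw [Measure.map_apply measurable_snd hs, Measure.compProd_apply (measurable_snd hs),
      lintegral_map (Kernel.measurable_kernel_prodMk_left (measurable_snd hs)) (by fun_prop)]
    have hm : Measurable fun x => P x s := P.measurable_coe hs
    calc ∫⁻ w, P (w n) s ∂(chainLaw P μ) = ∫⁻ x, P x s ∂μ := by
          rw [← ih, lintegral_map hm (measurable_pi_apply n), ih]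
      _ = μ s := by
          rw [← Measure.bind_apply hs P.aemeasurable, hP.def]

theorem memLp_eval_chainLaw (hP : P.Invariant μ) (f : Lp ℝ 2 μ) (n : ℕ) :
    MemLp (fun w : ℕ → X => f (w n)) 2 (chainLaw P μ) :=
  (Lp.memLp f).comp_measurePreserving (measurePreserving_eval_chainLaw hP n)

/-- The autocovariances of the stationary chain, by applying the Markov property at the last
time. -/
theorem integral_mul_eval_chainLaw (hP : P.Invariant μ) (i k : ℕ) (g f : Lp ℝ 2 μ) :
    ∫ w, g (w i) * f (w (i + k)) ∂(chainLaw P μ) = ⟪g, (markovOperator hP ^ k) f⟫_ℝ := by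
  have hm : ∀ f : Lp ℝ 2 μ, Measurable (f : X → ℝ) := fun f => (Lp.stronglyMeasurable f).measurable
  induction k generalizing f with
  | zero =>
    have hmg := hm g
    have hmf := hm f
    rw [add_zero, pow_zero, one_apply_eq_self, L2.inner_def, integral_comp_measurePreserving
      (measurePreserving_eval_chainLaw hP i) (g := fun x => g x * f x) (by fun_prop)]
    simp [mul_comm]
  | succ k ih =>
    have hmg := hm g
    have hmf := hm f
    have hmf' := hm (markovOperator hP f)
    rw [pow_succ, mul_apply_eq_comp, ← ih]
    have hint : Integrable (fun w : ℕ → X => g (w i) * f (w (i + k + 1))) (chainLaw P μ) :=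
      (memLp_eval_chainLaw hP g i).integrable_mul (memLp_eval_chainLaw hP f (i + k + 1))
    let e : (ℕ → X) → ((j : Finset.Iic (i + k)) → X) × X :=
      fun w => (Preorder.frestrictLe (π := fun _ => X) (i + k) w, w (i + k + 1))
    have he : Measurable e := by fun_prop
    let G : ((j : Finset.Iic (i + k)) → X) × X → ℝ :=
      fun z => g (z.1 ⟨i, Finset.mem_Iic.2 (Nat.le_add_right i k)⟩) * f z.2
    have hG : Measurable G := by fun_prop
    have h1 : ∫ w, g (w i) * f (w (i + (k + 1))) ∂(chainLaw P μ)
        = ∫ z, G z ∂((chainLaw P μ).map e) := by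
      rw [integral_map he.aemeasurable hG.aestronglyMeasurable]
      rfl
    have hint' : Integrable G ((chainLaw P μ).map e) :=
      (integrable_map_measure hG.aestronglyMeasurable he.aemeasurable).2 hint
    rw [h1]
    rw [← map_chainLaw_succ] at hint' ⊢
    rw [Measure.integral_compProd hint', integral_map (by fun_prop)]
    · refine integral_congr_ae ?_
      filter_upwards [(measurePreserving_eval_chainLaw hP (i + k)).quasiMeasurePreserving.ae
        (markovOperator_ae_eq hP f)] with w hw
      simp only [G]
      rw [integral_const_mul, hw]
      rfl
    · exact (integrable_integral_of_compProd hint').aestronglyMeasurable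

theorem integral_mul_eval_chainLaw_dist (hP : P.Invariant μ) (i j : ℕ) (f : Lp ℝ 2 μ) :
    ∫ w, f (w i) * f (w j) ∂(chainLaw P μ)
      = ⟪f, (markovOperator hP ^ Nat.dist i j) f⟫_ℝ := by
  have key : ∀ i k, ∫ w, f (w i) * f (w (i + k)) ∂(chainLaw P μ)
      = ⟪f, (markovOperator hP ^ Nat.dist i (i + k)) f⟫_ℝ := fun i k => by
    rw [integral_mul_eval_chainLaw hP, Nat.dist_eq_sub_of_le (Nat.le_add_right i k),
      Nat.add_sub_cancel_left]
  rcases le_total i j with h | h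
  · obtain ⟨k, rfl⟩ := Nat.exists_eq_add_of_le h
    exact key i k
  · obtain ⟨k, rfl⟩ := Nat.exists_eq_add_of_le h
    rw [Nat.dist_comm, ← key]
    exact integral_congr_ae (ae_of_all _ fun w => mul_comm _ _)

/-- The centred version `f - μ(f)` of a square integrable `f`, as an element of `L²(μ)`. -/
noncomputable def centred {f : X → ℝ} (hf : MemLp f 2 μ) : Lp ℝ 2 μ :=
  (hf.sub (memLp_const (∫ x, f x ∂μ))).toLp

theorem centred_ae_eq {f : X → ℝ} (hf : MemLp f 2 μ) :
    centred hf =ᵐ[μ] fun x => f x - ∫ x, f x ∂μ := MemLp.coeFn_toLp _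

theorem integral_centred {f : X → ℝ} (hf : MemLp f 2 μ) : ∫ x, centred hf x ∂μ = 0 := by
  rw [integral_congr_ae (centred_ae_eq hf),
    integral_sub (hf.integrable one_le_two) (integrable_const _)]
  simp

theorem evariance_eq_norm_centred {f : X → ℝ} (hf : MemLp f 2 μ) :
    evariance f μ = ENNReal.ofReal ⟪centred hf, centred hf⟫_ℝ := by
  rw [← hf.ofReal_variance_eq, variance_eq_integral hf.1.aemeasurable, L2.inner_def]
  congr 1
  refine integral_congr_ae ?_
  filter_upwards [centred_ae_eq hf] with x hx
  rw [hx]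
  simp [sq]

/-- The variances defining the asymptotic variance are the Fejér means of the autocovariances. -/
theorem scaledVariance_eq (hP : P.Invariant μ) {f : X → ℝ} (hf : MemLp f 2 μ) (n : ℕ) :
    scaledVariance P μ f n = ENNReal.ofReal ((n : ℝ)⁻¹ * ∑ i ∈ Finset.range n,
      ∑ j ∈ Finset.range n, ⟪centred hf, (markovOperator hP ^ Nat.dist i j) (centred hf)⟫_ℝ) := by
  set F := centred hf
  have hae : (fun w : ℕ → X => (Real.sqrt n)⁻¹ * ∑ i ∈ Finset.range n, (f (w i) - ∫ x, f x ∂μ))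
      =ᵐ[chainLaw P μ] fun w => (Real.sqrt n)⁻¹ * ∑ i ∈ Finset.range n, F (w i) := by
    have h : ∀ᵐ w ∂(chainLaw P μ), ∀ i : ℕ, F (w i) = f (w i) - ∫ x, f x ∂μ :=
      ae_all_iff.2 fun i =>
        (measurePreserving_eval_chainLaw hP i).quasiMeasurePreserving.ae (centred_ae_eq hf)
    filter_upwards [h] with w hw
    simp only [hw]
  have hmem : MemLp (fun w : ℕ → X => (Real.sqrt n)⁻¹ * ∑ i ∈ Finset.range n, F (w i)) 2
      (chainLaw P μ) :=
    (memLp_finsetSum _ fun i _ => memLp_eval_chainLaw hP F i).const_mul _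
  have hmean : ∀ i, ∫ w, F (w i) ∂(chainLaw P μ) = 0 := fun i => by
    rw [integral_comp_measurePreserving (measurePreserving_eval_chainLaw hP i)
      (Lp.stronglyMeasurable F).measurable, integral_centred hf]
  rw [scaledVariance, evariance_congr hae, ← hmem.ofReal_variance_eq,
    variance_of_integral_eq_zero hmem.1.aemeasurable]
  · congr 1
    simp_rw [mul_pow, inv_pow, Real.sq_sqrt (Nat.cast_nonneg n), sq, Finset.sum_mul_sum]
    rw [integral_const_mul, integral_finsetSum]
    · congr 1
      refine Finset.sum_congr rfl fun i _ => ?_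
      rw [integral_finsetSum]
      · simp_rw [integral_mul_eval_chainLaw_dist hP]
      · exact fun j _ => (memLp_eval_chainLaw hP F i).integrable_mul (memLp_eval_chainLaw hP F j)
    · exact fun i _ => integrable_finsetSum _ fun j _ =>
        (memLp_eval_chainLaw hP F i).integrable_mul (memLp_eval_chainLaw hP F j)
  · rw [integral_const_mul, integral_finsetSum _ fun i _ =>
      (memLp_eval_chainLaw hP F i).integrable one_le_two]
    simp [hmean]

end Chain

/-! ### Comparison of two reversible kernels -/

section Comparison

variable {X : Type*} [MeasurableSpace X] {μ : Measure X} [IsProbabilityMeasure μ]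
  {P P' : Kernel X X} [IsMarkovKernel P] [IsMarkovKernel P']

/-- The autocovariances `⟪f, P ^ k f⟫` of the centred `f`. -/
noncomputable def autocov (hP : P.Invariant μ) {f : X → ℝ} (hf : MemLp f 2 μ) (k : ℕ) : ℝ :=
  ⟪centred hf, (markovOperator hP ^ k) (centred hf)⟫_ℝ

theorem isReversibleSeq_autocov (hP : P.IsReversible μ) {f : X → ℝ} (hf : MemLp f 2 μ) :
    IsReversibleSeq (autocov hP.invariant hf) :=
  isReversibleSeq_inner_pow (norm_markovOperator_le _) (markovOperator_symm hP) _

theorem tendsto_scaledVariance_of_bddAbove (hP : P.IsReversible μ) {f : X → ℝ}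
    (hf : MemLp f 2 μ)
    (hb : BddAbove (Set.range fun j => ∑ k ∈ Finset.range (2 * j), autocov hP.invariant hf k)) :
    ∃ L, Tendsto (scaledVariance P μ f) atTop
        (𝓝 (ENNReal.ofReal (L - autocov hP.invariant hf 0))) ∧
      Tendsto (fun x => 2 * ∑' k, autocov hP.invariant hf k * x ^ k) (𝓝[<] 1) (𝓝 L) := by
  obtain ⟨L, h1, h2⟩ := (isReversibleSeq_autocov hP hf).tendsto_of_bddAbove hb
  refine ⟨L, (ENNReal.tendsto_ofReal h1).congr fun n => ?_, h2⟩
  exact (scaledVariance_eq hP.invariant hf n).symm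

theorem tendsto_scaledVariance_of_not_bddAbove (hP : P.IsReversible μ) {f : X → ℝ}
    (hf : MemLp f 2 μ)
    (hb : ¬ BddAbove
      (Set.range fun j => ∑ k ∈ Finset.range (2 * j), autocov hP.invariant hf k)) :
    Tendsto (scaledVariance P μ f) atTop (𝓝 ∞) := by
  refine (ENNReal.tendsto_ofReal_nhds_top.2
    ((isReversibleSeq_autocov hP hf).tendsto_atTop_of_not_bddAbove hb)).congr fun n => ?_
  exact (scaledVariance_eq hP.invariant hf n).symm

theorem tendsto_scaledVariance (hP : P.IsReversible μ) {f : X → ℝ} (hf : MemLp f 2 μ) :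
    Tendsto (scaledVariance P μ f) atTop (𝓝 (asymptoticVariance P μ f)) := by
  have key : ∃ v, Tendsto (scaledVariance P μ f) atTop (𝓝 v) := by
    by_cases hb : BddAbove
      (Set.range fun j => ∑ k ∈ Finset.range (2 * j), autocov hP.invariant hf k)
    · obtain ⟨L, h, -⟩ := tendsto_scaledVariance_of_bddAbove hP hf hb
      exact ⟨_, h⟩
    · exact ⟨_, tendsto_scaledVariance_of_not_bddAbove hP hf hb⟩
  obtain ⟨v, hv⟩ := key
  have : asymptoticVariance P μ f = v := hv.limsup_eq
  rwa [this]

/-- If the Dirichlet form of `P'` is at least `ϱ` times that of `P`, then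
`var(f, P') ≤ (ϱ⁻¹ - 1) var(f) + ϱ⁻¹ var(f, P)`. Twice the Abel sum of the autocovariances has
the limit `var(f, P) + var(f)`, and passing from `P` to `P'` multiplies it by `ϱ⁻¹` at most. -/
theorem asymptoticVariance_le (hP : P.IsReversible μ) (hP' : P'.IsReversible μ) {ϱ : ℝ≥0}
    (hϱ0 : 0 < ϱ) (hϱ1 : ϱ ≤ 1)
    (hle : ∀ f : X → ℝ, MemLp f 2 μ → (ϱ : ℝ≥0∞) * dirichletForm P μ f ≤ dirichletForm P' μ f)
    {f : X → ℝ} (hf : MemLp f 2 μ) :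
    asymptoticVariance P' μ f
      ≤ ((ϱ : ℝ≥0∞)⁻¹ - 1) * evariance f μ + (ϱ : ℝ≥0∞)⁻¹ * asymptoticVariance P μ f := by
  by_cases hb : BddAbove
      (Set.range fun j => ∑ k ∈ Finset.range (2 * j), autocov hP.invariant hf k)
  swap
  -- unbounded sums mean `var(f, P) = ∞`, and the right-hand side is infinite
  · have h : asymptoticVariance P μ f = ∞ :=
      (tendsto_scaledVariance_of_not_bddAbove hP hf hb).limsup_eq
    rw [h, ENNReal.mul_top (by simp)]
    simp
  have hϱ0' : (0 : ℝ) < ϱ := hϱ0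
  have hle' : ∀ u : Lp ℝ 2 μ, (ϱ : ℝ) * ⟪u, u - markovOperator hP.invariant u⟫_ℝ
      ≤ ⟪u, u - markovOperator hP'.invariant u⟫_ℝ := fun u => by
    have h := hle u (Lp.memLp u)
    have h0 := one_sub_inner_nonneg (norm_markovOperator_le hP'.invariant) zero_le_one le_rfl u
    rw [one_smul] at h0
    rwa [dirichletForm_coe hP.invariant, dirichletForm_coe hP'.invariant,
      ← ENNReal.ofReal_coe_nnreal, ← ENNReal.ofReal_mul ϱ.coe_nonneg, ENNReal.ofReal_le_ofReal_iff h0] at h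
  obtain ⟨L, hL, habel⟩ := tendsto_scaledVariance_of_bddAbove hP hf hb
  have hcomp : ∀ᶠ x in 𝓝[<] (1 : ℝ), ∑' k, autocov hP'.invariant hf k * x ^ k
      ≤ (ϱ : ℝ)⁻¹ * ∑' k, autocov hP.invariant hf k * x ^ k := by
    filter_upwards [Ioo_mem_nhdsLT (show (0 : ℝ) < 1 by norm_num)] with x hx
    exact abel_sum_le (norm_markovOperator_le _) (norm_markovOperator_le _)
      (markovOperator_symm hP) hϱ0' hϱ1 hle' _ hx.1.le hx.2
  -- the Abel sums of `P'` are bounded, so `var(f, P')` is finite as well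
  have hb' : BddAbove
      (Set.range fun j => ∑ k ∈ Finset.range (2 * j), autocov hP'.invariant hf k) := by
    refine (isReversibleSeq_autocov hP' hf).bddAbove_of_abel (K := (ϱ : ℝ)⁻¹ * ((L + 1) / 2)) ?_
    filter_upwards [hcomp, habel.eventually_lt_const (lt_add_one L)] with x hx hx'
    refine hx.trans (mul_le_mul_of_nonneg_left ?_ (by positivity))
    linarith
  obtain ⟨L', hL', habel'⟩ := tendsto_scaledVariance_of_bddAbove hP' hf hb'
  have hLL : L' ≤ (ϱ : ℝ)⁻¹ * L := by
    refine le_of_tendsto_of_tendsto habel' (habel.const_mul _) ?_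
    filter_upwards [hcomp] with x hx
    linarith
  have h0 : ∀ {Q : Kernel X X} [IsMarkovKernel Q] (hQ : Q.Invariant μ),
      autocov hQ hf 0 = ⟪centred hf, centred hf⟫_ℝ := fun hQ => by simp [autocov]
  have e1 : asymptoticVariance P μ f = _ := hL.limsup_eq
  have e2 : asymptoticVariance P' μ f = _ := hL'.limsup_eq
  rw [e1, e2, h0, h0, evariance_eq_norm_centred hf]
  have hσ : 0 ≤ ⟪centred hf, centred hf⟫_ℝ := real_inner_self_nonneg
  have hinv : (ϱ : ℝ≥0∞)⁻¹ = ENNReal.ofReal (ϱ : ℝ)⁻¹ := by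
    rw [ENNReal.ofReal_inv_of_pos hϱ0', ENNReal.ofReal_coe_nnreal]
  have hϱinv : (1 : ℝ) ≤ (ϱ : ℝ)⁻¹ := (one_le_inv₀ hϱ0').2 hϱ1
  rw [hinv, ← ENNReal.ofReal_one, ← ENNReal.ofReal_sub _ zero_le_one,
    ← ENNReal.ofReal_mul (by linarith), ← ENNReal.ofReal_mul (by positivity)]
  refine le_trans (ENNReal.ofReal_le_ofReal ?_) ENNReal.ofReal_add_le
  linarith

theorem mul_spectralGap_le {X : Type*} [MeasurableSpace X] {μ : Measure X} {P P' : Kernel X X}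
    {r : ℝ≥0∞}
    (hle : ∀ f : X → ℝ, MemLp f 2 μ → r * dirichletForm P μ f ≤ dirichletForm P' μ f) :
    r * spectralGap P μ ≤ spectralGap P' μ := by
  refine le_iInf fun f => le_iInf fun hf => le_iInf fun h0 => le_iInf fun hne => ?_
  have h : spectralGap P μ ≤ dirichletForm P μ f / ∫⁻ x, ENNReal.ofReal (f x ^ 2) ∂μ :=
    iInf_le_of_le f (iInf_le_of_le hf (iInf_le_of_le h0 (iInf_le _ hne)))
  calc r * spectralGap P μ
      ≤ r * (dirichletForm P μ f / ∫⁻ x, ENNReal.ofReal (f x ^ 2) ∂μ) := by gcongr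
    _ = r * dirichletForm P μ f / ∫⁻ x, ENNReal.ofReal (f x ^ 2) ∂μ := (mul_div_assoc _ _ _).symm
    _ ≤ _ := ENNReal.div_le_div_right (hle f hf) _

end Comparison

/-! ### Accept-reject kernels -/

section AcceptReject

variable {X : Type*} [MeasurableSpace X] {ν : Measure X}

instance (M : MHData ν) : IsProbabilityMeasure M.target :=
  ⟨by rw [MHData.target, withDensity_apply _ MeasurableSet.univ, setLIntegral_univ, M.lintegral_π]⟩

variable [SigmaFinite ν]

theorem acceptKernel_apply (q a : X → X → ℝ≥0) (hq : Measurable (Function.uncurry q))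
    (ha : Measurable (Function.uncurry a)) (x : X) {B : Set X} (hB : MeasurableSet B) :
    acceptKernel ν q a hq ha x B = ∫⁻ y in B, (q x y : ℝ≥0∞) * a x y ∂ν
      + (1 - ∫⁻ y, (q x y : ℝ≥0∞) * a x y ∂ν) * B.indicator 1 x := by
  change (ν.withDensity (fun y => (q x y : ℝ≥0∞) * a x y)
    + (1 - ∫⁻ y, (q x y : ℝ≥0∞) * a x y ∂ν) • Measure.dirac x) B = _
  rw [Measure.add_apply, Measure.smul_apply, withDensity_apply _ hB, Measure.dirac_apply' _ hB,
    smul_eq_mul]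

/-- Detailed balance: if `π(x) q(x,y) a(x,y)` is symmetric in `x` and `y`, the accept-reject
kernel is reversible with respect to `π`. -/
theorem acceptKernel_isReversible {p : X → ℝ≥0} (hp : Measurable p) (q a : X → X → ℝ≥0)
    (hq : Measurable (Function.uncurry q)) (ha : Measurable (Function.uncurry a))
    (hsymm : ∀ x y, p x * (q x y * a x y) = p y * (q y x * a y x)) :
    (acceptKernel ν q a hq ha).IsReversible (ν.withDensity fun x => (p x : ℝ≥0∞)) := by
  have hqa : Measurable (Function.uncurry fun x y => (q x y : ℝ≥0∞) * a x y) :=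
    hq.coe_nnreal_ennreal.mul ha.coe_nnreal_ennreal
  have hp' : Measurable fun x => (p x : ℝ≥0∞) := hp.coe_nnreal_ennreal
  have key : ∀ ⦃A B : Set X⦄, MeasurableSet A → MeasurableSet B →
      ∫⁻ x in A, acceptKernel ν q a hq ha x B ∂(ν.withDensity fun x => (p x : ℝ≥0∞))
        = (∫⁻ x in A, ∫⁻ y in B, (p x : ℝ≥0∞) * (q x y * a x y) ∂ν ∂ν)
          + ∫⁻ x in A ∩ B, (p x : ℝ≥0∞) * (1 - ∫⁻ y, (q x y : ℝ≥0∞) * a x y ∂ν) ∂ν := by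
    intro A B hA hB
    have hm1 : Measurable fun x => ∫⁻ y in B, (q x y : ℝ≥0∞) * a x y ∂ν :=
      hqa.lintegral_prod_right'
    have hm2 : Measurable fun x => (p x : ℝ≥0∞) * ∫⁻ y in B, (q x y : ℝ≥0∞) * a x y ∂ν :=
      hp'.mul hm1
    rw [restrict_withDensity hA, lintegral_withDensity_eq_lintegral_mul _ hp'
      (Kernel.measurable_coe _ hB)]
    simp only [Pi.mul_apply, acceptKernel_apply q a hq ha _ hB, mul_add]
    rw [lintegral_add_left hm2, Set.inter_comm A B, ← Measure.restrict_restrict hB,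
      ← lintegral_indicator hB]
    congr 1
    · refine lintegral_congr fun x => ?_
      exact (lintegral_const_mul _ (hqa.comp measurable_prodMk_left)).symm
    · refine lintegral_congr fun x => ?_
      by_cases hx : x ∈ B <;> simp [hx]
  intro A B hA hB
  rw [key hA hB, key hB hA, Set.inter_comm A B, lintegral_lintegral_swap]
  · congr 1
    refine lintegral_congr fun y => lintegral_congr fun x => ?_
    exact_mod_cast hsymm x y
  · exact ((hp'.comp measurable_fst).mul hqa).aemeasurable

/-- Rejected proposals do not move the chain, so only accepted ones contribute. -/
theorem dirichletForm_acceptKernel {μ : Measure X} (q a : X → X → ℝ≥0)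
    (hq : Measurable (Function.uncurry q)) (ha : Measurable (Function.uncurry a)) {f : X → ℝ}
    (hf : Measurable f) :
    dirichletForm (acceptKernel ν q a hq ha) μ f
      = (1 / 2) * ∫⁻ x, ∫⁻ y, (q x y : ℝ≥0∞) * a x y * ENNReal.ofReal ((f x - f y) ^ 2) ∂ν ∂μ := by
  rw [dirichletForm]
  congr 1
  refine lintegral_congr fun x => ?_
  have hm : Measurable fun y => ENNReal.ofReal ((f x - f y) ^ 2) := by fun_prop
  have hqa : Measurable fun y => (q x y : ℝ≥0∞) * a x y :=
    (hq.comp measurable_prodMk_left).coe_nnreal_ennreal.mul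
      (ha.comp measurable_prodMk_left).coe_nnreal_ennreal
  change ∫⁻ y, _ ∂(ν.withDensity (fun y => (q x y : ℝ≥0∞) * a x y)
    + (1 - ∫⁻ y, (q x y : ℝ≥0∞) * a x y ∂ν) • Measure.dirac x) = _
  rw [lintegral_add_measure, lintegral_smul_measure, lintegral_dirac' _ hm,
    lintegral_withDensity_eq_lintegral_mul _ hqa hm]
  simp

theorem mul_dirichletForm_acceptKernel_le {μ : Measure X} (q a a' : X → X → ℝ≥0)
    (hq : Measurable (Function.uncurry q)) (ha : Measurable (Function.uncurry a))
    (ha' : Measurable (Function.uncurry a')) {r : ℝ≥0} (h : ∀ x y, r * a x y ≤ a' x y)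
    {f : X → ℝ} (hf : Measurable f) :
    (r : ℝ≥0∞) * dirichletForm (acceptKernel ν q a hq ha) μ f
      ≤ dirichletForm (acceptKernel ν q a' hq ha') μ f := by
  rw [dirichletForm_acceptKernel q a hq ha hf, dirichletForm_acceptKernel q a' hq ha' hf,
    mul_left_comm, ← lintegral_const_mul' _ _ ENNReal.coe_ne_top]
  gcongr with x
  rw [← lintegral_const_mul' _ _ ENNReal.coe_ne_top]
  refine lintegral_mono fun y => ?_
  have h' : (r : ℝ≥0∞) * a x y ≤ a' x y := by exact_mod_cast h x y
  calc (r : ℝ≥0∞) * ((q x y : ℝ≥0∞) * a x y * ENNReal.ofReal ((f x - f y) ^ 2))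
      = (q x y : ℝ≥0∞) * (r * a x y) * ENNReal.ofReal ((f x - f y) ^ 2) := by ring
    _ ≤ _ := by gcongr

end AcceptReject

/-! ### Acceptance probabilities -/

section Acceptance

variable {X : Type*} [MeasurableSpace X] {ν : Measure X} {M : MHData ν} {d : ℕ}

theorem MHData.ratio_inv (M : MHData ν) (x y : X) : M.ratio y x = (M.ratio x y)⁻¹ := by
  rw [MHData.ratio, MHData.ratio, inv_div]

theorem min_one_eq_mul_min_one_inv {r : ℝ≥0} (hr : r ≠ 0) : min 1 r = r * min 1 r⁻¹ := by
  rw [mul_min, mul_one, mul_inv_cancel₀ hr, min_comm]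

theorem MHData.detailed_balance (M : MHData ν) (x y : X) :
    M.π x * (M.q x y * M.accept x y) = M.π y * (M.q y x * M.accept y x) := by
  have key : ∀ u v : ℝ≥0, u * min 1 (v / u) = min u v := fun u v => by
    rcases eq_or_ne u 0 with rfl | hu
    · simp
    · rw [mul_min, mul_one, mul_div_cancel₀ _ hu]
  simp only [MHData.accept, MHData.ratio, ← mul_assoc]
  rw [key, key, min_comm]

/-- The balance condition `ρ k x y = (ρ k y x)⁻¹` gives `1 ∧ ρ = ρ (1 ∧ ρ⁻¹)` factor by factor. -/
theorem Factorisation.accept_eq_ratio_mul (F : Factorisation M d) {x y : X}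
    (hxy : 0 < M.π x * M.q x y) (hyx : 0 < M.π y * M.q y x) :
    F.accept x y = M.ratio x y * F.accept y x := by
  have hr : M.ratio x y ≠ 0 := (div_pos hyx hxy).ne'
  rw [F.prod_eq x y hxy] at hr ⊢
  rw [Factorisation.accept, Factorisation.accept, ← Finset.prod_mul_distrib]
  refine Finset.prod_congr rfl fun k hk => ?_
  rw [min_one_eq_mul_min_one_inv (Finset.prod_ne_zero_iff.1 hr k hk), F.balance k y x hyx hxy]

theorem Factorisation.accept_eq_zero (F : Factorisation M d) {x y : X}
    (hxy : 0 < M.π x * M.q x y) (hyx : M.π y * M.q y x = 0) : F.accept x y = 0 := by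
  have hr : M.ratio x y = 0 := by rw [MHData.ratio, hyx, zero_div]
  rw [F.prod_eq x y hxy] at hr
  obtain ⟨k, hk, h0⟩ := Finset.prod_eq_zero_iff.1 hr
  exact Finset.prod_eq_zero hk (by rw [h0]; exact min_eq_right zero_le_one)

theorem Factorisation.detailed_balance (F : Factorisation M d) (x y : X) :
    M.π x * (M.q x y * F.accept x y) = M.π y * (M.q y x * F.accept y x) := by
  simp only [← mul_assoc]
  rcases (zero_le (a := M.π x * M.q x y)).eq_or_lt with hxy | hxy
  · rcases (zero_le (a := M.π y * M.q y x)).eq_or_lt with hyx | hyx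
    · rw [← hxy, ← hyx, zero_mul, zero_mul]
    · rw [← hxy, F.accept_eq_zero hyx hxy.symm, zero_mul, mul_zero]
  · rcases (zero_le (a := M.π y * M.q y x)).eq_or_lt with hyx | hyx
    · rw [← hyx, F.accept_eq_zero hxy hyx.symm, zero_mul, mul_zero]
    · rw [F.accept_eq_ratio_mul hxy hyx, ← mul_assoc, MHData.ratio, mul_div_cancel₀ _ hxy.ne']

/-- If the product of the `ρ k` is at least `1`, one of them is, and contributes the factor `1`;
each of the other `d - 1` factors contributes at least `c`. -/
theorem pow_le_prod_min_one {c : ℝ≥0} (hc1 : c ≤ 1) (hd : 1 ≤ d) {ρ : Fin d → ℝ≥0}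
    (hρ : ∀ k, c ≤ ρ k) (hprod : 1 ≤ ∏ k, ρ k) : c ^ (d - 1) ≤ ∏ k, min 1 (ρ k) := by
  have hex : ∃ k, 1 ≤ ρ k := by
    by_contra! h
    have hlt : ∏ k, ρ k < 1 := by
      rw [← Finset.mul_prod_erase _ _ (Finset.mem_univ (⟨0, hd⟩ : Fin d))]
      exact (mul_le_of_le_one_right' (Finset.prod_le_one' fun k _ => (h k).le)).trans_lt (h _)
    exact absurd hprod hlt.not_ge
  obtain ⟨k, hk⟩ := hex
  rw [← Finset.mul_prod_erase _ _ (Finset.mem_univ k), min_eq_left hk, one_mul]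
  have hcard : (Finset.univ.erase k).card = d - 1 := by simp
  rw [← hcard]
  exact Finset.pow_card_le_prod _ _ _ fun j _ => le_min hc1 (hρ j)

/-- Where `r ≥ 1` this is the bound on the factors. Where `0 < r < 1` it follows from the bound at
the swapped pair, since `α(x,y) = r(x,y) α(y,x)` holds for both acceptance probabilities. -/
theorem Factorisation.pow_mul_accept_le (F : Factorisation M d) (hd : 1 ≤ d) {c : ℝ≥0}
    (hc1 : c ≤ 1) (hc : ∀ x y, 1 ≤ M.ratio x y → ∀ k, c ≤ F.ρ k x y) (x y : X) :
    c ^ (d - 1) * M.accept x y ≤ F.accept x y := by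
  have hpos : ∀ x y, M.ratio x y ≠ 0 → 0 < M.π x * M.q x y ∧ 0 < M.π y * M.q y x :=
    fun x y h => by
      rw [MHData.ratio, div_ne_zero_iff] at h
      exact ⟨pos_iff_ne_zero.2 h.2, pos_iff_ne_zero.2 h.1⟩
  have hge : ∀ x y, 1 ≤ M.ratio x y → c ^ (d - 1) ≤ F.accept x y := fun x y h => by
    refine pow_le_prod_min_one hc1 hd (hc x y h) ?_
    rwa [← F.prod_eq x y (hpos x y (zero_lt_one.trans_le h).ne').1]
  rcases le_or_gt 1 (M.ratio x y) with h | h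
  · rw [MHData.accept, min_eq_left h, mul_one]
    exact hge x y h
  · rw [MHData.accept, min_eq_right h.le]
    rcases eq_or_ne (M.ratio x y) 0 with h0 | h0
    · rw [h0, mul_zero]
      exact zero_le
    · obtain ⟨hxy, hyx⟩ := hpos x y h0
      rw [F.accept_eq_ratio_mul hxy hyx, mul_comm]
      refine mul_le_mul_right (hge y x ?_) _
      rw [M.ratio_inv]
      exact (one_le_inv₀ (pos_iff_ne_zero.2 h0)).2 h.le

variable [SigmaFinite ν]

theorem MHData.kernel_isReversible (M : MHData ν) : M.kernel.IsReversible M.target :=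
  acceptKernel_isReversible M.measurable_π _ _ _ _ M.detailed_balance

theorem Factorisation.kernel_isReversible (F : Factorisation M d) :
    F.kernel.IsReversible M.target :=
  acceptKernel_isReversible M.measurable_π _ _ _ _ F.detailed_balance

theorem Factorisation.mul_dirichletForm_le (F : Factorisation M d) (hd : 1 ≤ d) {c : ℝ≥0}
    (hc1 : c ≤ 1) (hc : ∀ x y, 1 ≤ M.ratio x y → ∀ k, c ≤ F.ρ k x y) {f : X → ℝ}
    (hf : AEStronglyMeasurable f M.target) :
    ((c ^ (d - 1) : ℝ≥0) : ℝ≥0∞) * dirichletForm M.kernel M.target f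
      ≤ dirichletForm F.kernel M.target f := by
  rw [dirichletForm_congr M.kernel_isReversible.invariant hf.ae_eq_mk,
    dirichletForm_congr F.kernel_isReversible.invariant hf.ae_eq_mk]
  exact mul_dirichletForm_acceptKernel_le _ _ _ _ _ _ (F.pow_mul_accept_le hd hc1 hc)
    hf.stronglyMeasurable_mk.measurable

end Acceptance

end DelayedAcceptance

theorem mainTheorem2 {X : Type*} [MeasurableSpace X] (ν : Measure X) [SigmaFinite ν]
    (M : DelayedAcceptance.MHData ν) (d : ℕ) (hd : 1 ≤ d)
    (F : DelayedAcceptance.Factorisation M d)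
    (c : ℝ≥0) (hc0 : 0 < c) (hc1 : c ≤ 1)
    (hc : ∀ x y, 1 ≤ M.ratio x y → ∀ k, c ≤ F.ρ k x y) :
    -- both kernels are reversible with respect to the target
    (M.kernel.IsReversible M.target ∧ F.kernel.IsReversible M.target) ∧
    -- comparison of the Dirichlet forms
    (∀ f : X → ℝ, MemLp f 2 M.target →
      (c : ℝ≥0∞) ^ (d - 1) * DelayedAcceptance.dirichletForm M.kernel M.target f
        ≤ DelayedAcceptance.dirichletForm F.kernel M.target f) ∧
    -- comparison of the spectral gaps
    ((c : ℝ≥0∞) ^ (d - 1) * DelayedAcceptance.spectralGap M.kernel M.target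
        ≤ DelayedAcceptance.spectralGap F.kernel M.target) ∧
    -- the limits defining the asymptotic variances exist, and the asymptotic variances compare
    (∀ f : X → ℝ, MemLp f 2 M.target →
      Tendsto (DelayedAcceptance.scaledVariance M.kernel M.target f) atTop
        (𝓝 (DelayedAcceptance.asymptoticVariance M.kernel M.target f)) ∧
      Tendsto (DelayedAcceptance.scaledVariance F.kernel M.target f) atTop
        (𝓝 (DelayedAcceptance.asymptoticVariance F.kernel M.target f)) ∧
      DelayedAcceptance.asymptoticVariance F.kernel M.target f
        ≤ (((c : ℝ≥0∞) ^ (d - 1))⁻¹ - 1) * evariance f M.target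
          + ((c : ℝ≥0∞) ^ (d - 1))⁻¹
            * DelayedAcceptance.asymptoticVariance M.kernel M.target f) := by
  have hE : ∀ f : X → ℝ, MemLp f 2 M.target →
      ((c ^ (d - 1) : ℝ≥0) : ℝ≥0∞) * DelayedAcceptance.dirichletForm M.kernel M.target f
        ≤ DelayedAcceptance.dirichletForm F.kernel M.target f :=
    fun f hf => F.mul_dirichletForm_le hd hc1 hc hf.1
  rw [← ENNReal.coe_pow]
  refine ⟨⟨M.kernel_isReversible, F.kernel_isReversible⟩, hE,
    DelayedAcceptance.mul_spectralGap_le hE, fun f hf => ⟨?_, ?_, ?_⟩⟩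
  · exact DelayedAcceptance.tendsto_scaledVariance M.kernel_isReversible hf
  · exact DelayedAcceptance.tendsto_scaledVariance F.kernel_isReversible hf
  · exact DelayedAcceptance.asymptoticVariance_le M.kernel_isReversible F.kernel_isReversible
      (pow_pos hc0 _) (pow_le_one₀ zero_le hc1) hE hf
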